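/- Let $\mathbf A\in\mathbb R^{k\times n}$, let $\boldsymbol\lambda\in\mathbb R^k$ have non-negative entries (the dark current), let $\mathbf X$ be a random vector in $\mathbb R^n$ with $\mathbf A\mathbf X\in\mathbb R^k_+$ almost surely (for instance $\mathbf X\ge 0$ and $\mathbf A$ entrywise non-negative), and let $\mathbf Y=\mathcal P(\mathbf A\mathbf X+\boldsymbol\lambda)$, that is, $\mathbf Y$ takes values in $\mathbb Z_+^k$ and, with $0^0=1$, $$P_{\mathbf Y|\mathbf X}(\boldsymbol y|\boldsymbol x)=\prod_{i=1}^k \frac{1}{y_i!}\left([\mathbf A\boldsymbol x]_i+\lambda_i\right)^{y_i} e^{-([\mathbf A\boldsymbol x]_i+\lambda_i)} .$$ Assume that $\mathbf A\mathbf X+\boldsymbol\lambda$ is non-degenerate: no non-trivial linear combination of its coordinates is almost surely constant (when second moments are finite, this says that its covariance matrix has full rank). Let $\mathbf C\in\mathbb R^{n\times k}$ and $\mathbf b\in\mathbb R^n$, and consider the following four conditions: 1. $\boldsymbol\lambda=\mathbf 0$; 2. $\mathbf A\mathbf C$ is a diagonal matrix with $0<[\mathbf A\mathbf C]_{ii}<1$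 for all $i$; 3. $[\mathbf A\mathbf b]_i>0$ for all $i$; 4. the law of $\mathbf A\mathbf X$ is $\prod_{i=1}^k \mathsf{Gam}\left(\frac{1-[\mathbf A\mathbf C]_{ii}}{[\mathbf A\mathbf C]_{ii}},\frac{[\mathbf A\mathbf b]_i}{[\mathbf A\mathbf C]_{ii}}\right)$, where $\mathsf{Gam}(\alpha,\theta)$ is the gamma law with rate $\alpha$ and shape $\theta$, i.e. with density $\frac{\alpha^\theta}{\Gamma(\theta)}x^{\theta-1}e^{-\alpha x}$ on $x\ge 0$. If $k=n$, then $$\mathbb E[\mathbf X\mid\mathbf Y=\boldsymbol y]=\mathbf C\boldsymbol y+\mathbf b\quad\text{for all }\boldsymbol y\in\mathbb Z_+^k \tag{$*$}$$ holds if and only if all four conditions hold. For arbitrary $k$ and $n$, $(*)$ implies the four conditions, and the four conditions imply $\mathbb E[\mathbf A\mathbf X\mid\mathbf Y=\boldsymbol y]=\mathbf A(\mathbf C\boldsymbol y+\mathbf b)$ for all $\boldsymbol y\in\mathbb Z_+^k$. Here $\mathbb E[\mathbf Z\mid\mathbf Y=\boldsymbol y]=\boldsymbol z$ includes that $\mathbf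 Y=\boldsymbol y$ has positive probability and that $\mathbf Z$ is integrable on this event. -/

import Mathlib

open MeasureTheory ProbabilityTheory Matrix

noncomputable section

namespace PoissonChannel

/-- The channel law `P_{Y|X}(y|x) = ∏ᵢ ([A x]ᵢ + λᵢ)^{yᵢ} e^{-([A x]ᵢ + λᵢ)} / yᵢ!`, with `0 ^ 0 = 1`. -/
def channelPMF {k n : ℕ} (A : Matrix (Fin k) (Fin n) ℝ) (lam : Fin k → ℝ)
    (x : Fin n → ℝ) (y : Fin k → ℕ) : ℝ :=
  ∏ i, ((A *ᵥ x) i + lam i) ^ y i * Real.exp (-((A *ᵥ x) i + lam i)) / (y i).factorial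

/-- `Y = 𝒫(A X + λ)`: the conditional law of `Y` given `X = x` has probability mass function
`channelPMF A lam x`, i.e. `P(X ∈ B, Y = y) = ∫_B P_{Y|X}(y|x) dP_X(x)`. -/
def IsPoissonOutput {Ω : Type*} [MeasurableSpace Ω] (μ : Measure Ω) {k n : ℕ}
    (A : Matrix (Fin k) (Fin n) ℝ) (lam : Fin k → ℝ)
    (X : Ω → Fin n → ℝ) (Y : Ω → Fin k → ℕ) : Prop :=
  ∀ B : Set (Fin n → ℝ), MeasurableSet B → ∀ y : Fin k → ℕ,
    μ (X ⁻¹' B ∩ Y ⁻¹' {y}) = ∫⁻ x in B, ENNReal.ofReal (channelPMF A lam x y) ∂(μ.map X)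

/-- `E[Z | Y = y] = z`, for a discrete `Y`: the event `Y = y` has positive probability, `Z` is
integrable on it, and the mean of `Z` under the conditional probability given `Y = y` is `z`. -/
def HasCondMean {Ω : Type*} [MeasurableSpace Ω] (μ : Measure Ω) {k m : ℕ}
    (Z : Ω → Fin m → ℝ) (Y : Ω → Fin k → ℕ) (y : Fin k → ℕ) (z : Fin m → ℝ) : Prop :=
  0 < μ (Y ⁻¹' {y}) ∧ IntegrableOn Z (Y ⁻¹' {y}) μ ∧ ∫ ω, Z ω ∂μ[|Y ⁻¹' {y}] = z

/-- The vector of counts `y`, seen as a real vector. -/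
def toReal {k : ℕ} (y : Fin k → ℕ) : Fin k → ℝ := fun i => (y i : ℝ)

/-- A random vector is non-degenerate if no nontrivial linear combination of its coordinates is
almost surely constant. For square-integrable vectors this says that the covariance matrix has
full rank, see `nondegenerate_iff_det_covariance_ne_zero`; no second moment is needed here. -/
def Nondegenerate {Ω : Type*} [MeasurableSpace Ω] (μ : Measure Ω) {k : ℕ}
    (U : Ω → Fin k → ℝ) : Prop :=
  ∀ v : Fin k → ℝ, v ≠ 0 → ¬ ∃ a : ℝ, ∀ᵐ ω ∂μ, v ⬝ᵥ U ω = a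

theorem nondegenerate_iff_det_covariance_ne_zero {Ω : Type*} [MeasurableSpace Ω]
    (μ : Measure Ω) [IsProbabilityMeasure μ] {k : ℕ} (U : Ω → Fin k → ℝ)
    (hU : ∀ i, MemLp (fun ω => U ω i) 2 μ) :
    Nondegenerate μ U ↔
      (Matrix.of fun i j => cov[fun ω => U ω i, fun ω => U ω j; μ]).det ≠ 0 := by
  have hL : ∀ v : Fin k → ℝ, MemLp (fun ω => v ⬝ᵥ U ω) 2 μ := fun v => by
    simp only [dotProduct]
    exact memLp_finsetSum _ fun i _ => (hU i).const_mul (v i)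
  have key : ∀ (v : Fin k → ℝ) (W : Ω → ℝ), MemLp W 2 μ →
      cov[W, fun ω => v ⬝ᵥ U ω; μ] = ∑ j, cov[W, fun ω => U ω j; μ] * v j := by
    intro v W hW
    simp only [dotProduct]
    rw [covariance_fun_sum_right (fun i => (hU i).const_mul (v i)) hW]
    exact Finset.sum_congr rfl fun j _ => by rw [covariance_const_mul_right, mul_comm]
  rw [← not_iff_not, not_not, ← Matrix.exists_mulVec_eq_zero_iff]
  simp only [Nondegenerate, not_forall, not_not, exists_prop]
  refine exists_congr fun v => and_congr_right fun _ => ⟨?_, fun h => ?_⟩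
  · rintro ⟨a, ha⟩
    funext i
    have h0 : cov[fun ω => U ω i, fun ω => v ⬝ᵥ U ω; μ] = 0 := by
      have hm : ∫ ω, v ⬝ᵥ U ω ∂μ = a := by rw [integral_congr_ae ha]; simp
      rw [covariance, hm]
      refine integral_eq_zero_of_ae ?_
      filter_upwards [ha] with ω hω
      simp [hω]
    rw [key v _ (hU i)] at h0
    simpa [mulVec, dotProduct] using h0
  · refine ⟨_, ae_eq_integral_of_variance_eq_zero (hL v) ?_⟩
    rw [← covariance_self (hL v).aemeasurable, key v _ (hL v)]
    have h1 : ∀ i, cov[fun ω => U ω i, fun ω => v ⬝ᵥ U ω; μ] = 0 := fun i => by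
      rw [key v _ (hU i)]
      simpa [mulVec, dotProduct] using congrFun h i
    exact Finset.sum_eq_zero fun j _ => by rw [covariance_comm, h1 j, zero_mul]

/-- The four conditions that characterize a linear conditional mean. The gamma law
with shape `θ` and rate `α` is `gammaMeasure θ α`. -/
structure ProductGammaConditions {Ω : Type*} [MeasurableSpace Ω] (μ : Measure Ω) {k n : ℕ}
    (A : Matrix (Fin k) (Fin n) ℝ) (lam : Fin k → ℝ) (X : Ω → Fin n → ℝ)
    (C : Matrix (Fin n) (Fin k) ℝ) (b : Fin n → ℝ) : Prop where
  dark_current_eq_zero : lam = 0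
  isDiag : (A * C).IsDiag
  diag_mem : ∀ i, 0 < (A * C) i i ∧ (A * C) i i < 1
  pos : ∀ i, 0 < (A *ᵥ b) i
  law : μ.map (fun ω => A *ᵥ X ω) =
    Measure.pi fun i =>
      gammaMeasure ((A *ᵥ b) i / (A * C) i i) ((1 - (A * C) i i) / (A * C) i i)

end PoissonChannel

end

/-! Put U = AX + λ and m(y) = E ∏ U_i^{y_i} e^{-U_i}. The channel gives P(Y = y) = m(y)/∏ y_i! and
E[U_i | Y = y] = m(y + e_i)/m(y) (`IsPoissonOutput.hasCondMean_iff`). Applying A to a linear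
conditional mean thus gives m(y + e_i) = (Hy + c)_i m(y), with H = AC and c = Ab + λ.

Raising y along e_i and e_j in either order must give the same value, which makes rows i and j of H
proportional whenever H_ij ≠ 0 for some i ≠ j. Nondegeneracy of U excludes a left kernel of H, so H
is diagonal, with positive diagonal; summability of the probabilities of Y forces H_ii < 1. The
product of gamma laws satisfies the same recursion, and the moments m determine the law
(`eq_of_poissonMoment_eq`), so U has that law. Since it charges every neighbourhood of 0 in each
coordinate while U_i ≥ λ_i ≥ 0, λ vanishes.

Conversely, the gamma recursion yields the conditional mean of AX; for k = n, det(AC) ≠ 0 makes A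
invertible. -/

namespace PoissonChannel

open scoped Topology

/-! ### Moment determinacy on the line. -/

/-- Two real random variables with finite exponential moments near `0` and the same moments have
the same law. -/
theorem map_eq_of_moment_eq {Ω Ω' : Type*} [MeasurableSpace Ω] [MeasurableSpace Ω']
    {μ : Measure Ω} {μ' : Measure Ω'} [IsFiniteMeasure μ] [IsFiniteMeasure μ']
    {V : Ω → ℝ} {W : Ω' → ℝ}
    (hV : 0 ∈ interior (integrableExpSet V μ)) (hW : 0 ∈ interior (integrableExpSet W μ'))
    (h : ∀ n : ℕ, ∫ ω, V ω ^ n ∂μ = ∫ ω, W ω ^ n ∂μ') :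
    μ.map V = μ'.map W := by
  have hVm := aemeasurable_of_mem_interior_integrableExpSet hV
  have hWm := aemeasurable_of_mem_interior_integrableExpSet hW
  -- On this vertical strip both complex moment generating functions are analytic. Equal Taylor
  -- coefficients at 0 and the identity theorem make them agree there, in particular on the
  -- imaginary axis.
  set S : Set ℂ := {z | z.re ∈ interior (integrableExpSet V μ) ∩ interior (integrableExpSet W μ')}
  have hfV : AnalyticOnNhd ℂ (complexMGF V μ) S :=
    analyticOnNhd_complexMGF.mono fun z hz => hz.1
  have hfW : AnalyticOnNhd ℂ (complexMGF W μ') S :=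
    analyticOnNhd_complexMGF.mono fun z hz => hz.2
  have hS : IsPreconnected S :=
    ((convex_integrableExpSet.interior.inter convex_integrableExpSet.interior).linear_preimage
      Complex.reLm).isPreconnected
  have h0 : (0 : ℂ) ∈ S := ⟨by simpa using hV, by simpa using hW⟩
  have hder : ∀ n, iteratedDeriv n (complexMGF V μ) 0 = iteratedDeriv n (complexMGF W μ') 0 := by
    intro n
    rw [iteratedDeriv_complexMGF (by simpa using hV), iteratedDeriv_complexMGF (by simpa using hW)]
    have := congrArg (fun x : ℝ => (x : ℂ)) (h n)
    simp only [← integral_complex_ofReal] at this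
    simpa using this
  have hev : complexMGF V μ =ᶠ[𝓝 0] complexMGF W μ' := by
    have h1 := (hfV 0 h0).hasFPowerSeriesAt.eventually_hasSum_sub
    have h2 := (hfW 0 h0).hasFPowerSeriesAt.eventually_hasSum_sub
    simp only [hder] at h1
    filter_upwards [h1, h2] with z hz1 hz2 using hz1.unique hz2
  have heq := hfV.eqOn_of_preconnected_of_eventuallyEq hfW hS h0 hev
  have := Measure.isFiniteMeasure_map μ V
  have := Measure.isFiniteMeasure_map μ' W
  refine Measure.ext_of_charFun (funext fun t => ?_)
  rw [← complexMGF_mul_I hVm, ← complexMGF_mul_I hWm]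
  exact heq ⟨by simpa using hV, by simpa using hW⟩

/-! ### Poisson moments determine a measure. -/

variable {k : ℕ}

/-- The weight `∏ᵢ uᵢ^{yᵢ} e^{-uᵢ}`. -/
noncomputable def weight (y : Fin k → ℕ) (u : Fin k → ℝ) : ℝ :=
  ∏ i, (u i ^ y i * Real.exp (-u i))

/-- The moment `∫ ∏ᵢ uᵢ^{yᵢ} e^{-uᵢ} dP(u)`. -/
noncomputable def poissonMoment (P : Measure (Fin k → ℝ)) (y : Fin k → ℕ) : ℝ :=
  ∫ u, weight y u ∂P

@[fun_prop]
theorem measurable_weight (y : Fin k → ℕ) : Measurable (weight y) := by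
  unfold weight; fun_prop

theorem weight_eq (y : Fin k → ℕ) (u : Fin k → ℝ) :
    weight y u = Real.exp (-∑ i, u i) * ∏ i, u i ^ y i := by
  rw [weight, Finset.prod_mul_distrib, ← Real.exp_sum, Finset.sum_neg_distrib, mul_comm]

theorem weight_zero (u : Fin k → ℝ) : weight 0 u = Real.exp (-∑ i, u i) := by
  simp [weight_eq]

theorem weight_add_single (y : Fin k → ℕ) (i : Fin k) (u : Fin k → ℝ) :
    weight (y + Pi.single i 1) u = u i * weight y u := by
  have h : ∏ j, u j ^ ((y + Pi.single i 1 : Fin k → ℕ) j) = u i * ∏ j, u j ^ y j := by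
    simp only [Pi.add_apply, pow_add, Finset.prod_mul_distrib]
    rw [mul_comm]
    congr 1
    rw [Finset.prod_eq_single i (fun j _ hj => by simp [hj]) (by simp)]
    simp
  rw [weight_eq, weight_eq, h]
  ring

theorem weight_nonneg (y : Fin k → ℕ) {u : Fin k → ℝ} (hu : ∀ i, 0 ≤ u i) : 0 ≤ weight y u :=
  Finset.prod_nonneg fun i _ => mul_nonneg (pow_nonneg (hu i) _) (Real.exp_pos _).le

theorem weight_le (y : Fin k → ℕ) {u : Fin k → ℝ} (hu : ∀ i, 0 ≤ u i) :
    weight y u ≤ ∏ i, ((y i).factorial : ℝ) := by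
  refine Finset.prod_le_prod
    (fun i _ => mul_nonneg (pow_nonneg (hu i) _) (Real.exp_pos _).le) fun i _ => ?_
  have h := Real.pow_div_factorial_le_exp (u i) (hu i) (y i)
  rw [div_le_iff₀ (by positivity)] at h
  rw [Real.exp_neg, ← div_eq_mul_inv, div_le_iff₀ (Real.exp_pos _)]
  linarith

/-- On the orthant the weight is bounded, since u^n/n! ≤ e^u; no moment of P itself is needed. -/
theorem integrable_weight {P : Measure (Fin k → ℝ)} [IsFiniteMeasure P]
    (hP : ∀ᵐ u ∂P, ∀ i, 0 ≤ u i) (y : Fin k → ℕ) : Integrable (weight y) P := by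
  refine Integrable.of_bound (by fun_prop) (∏ i, ((y i).factorial : ℝ)) ?_
  filter_upwards [hP] with u hu
  rw [Real.norm_of_nonneg (weight_nonneg y hu)]
  exact weight_le y hu

/-- The measure `e^{-∑ᵢ uᵢ} dP(u)`. -/
noncomputable def expTilt (P : Measure (Fin k → ℝ)) : Measure (Fin k → ℝ) :=
  P.withDensity fun u => ENNReal.ofReal (Real.exp (-∑ i, u i))

theorem integral_expTilt (P : Measure (Fin k → ℝ)) (f : (Fin k → ℝ) → ℝ) :
    ∫ u, f u ∂expTilt P = ∫ u, Real.exp (-∑ i, u i) * f u ∂P := by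
  rw [expTilt, integral_withDensity_eq_integral_toReal_smul (by fun_prop) (by simp)]
  refine integral_congr_ae (.of_forall fun u => ?_)
  simp [ENNReal.toReal_ofReal (Real.exp_pos _).le]

theorem integrable_expTilt_iff {P : Measure (Fin k → ℝ)} {f : (Fin k → ℝ) → ℝ} :
    Integrable f (expTilt P) ↔ Integrable (fun u => Real.exp (-∑ i, u i) * f u) P := by
  rw [expTilt, integrable_withDensity_iff_integrable_smul' (by fun_prop) (by simp)]
  refine integrable_congr (.of_forall fun u => ?_)
  simp [ENNReal.toReal_ofReal (Real.exp_pos _).le]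

theorem isFiniteMeasure_expTilt {P : Measure (Fin k → ℝ)} [IsFiniteMeasure P]
    (hP : ∀ᵐ u ∂P, ∀ i, 0 ≤ u i) : IsFiniteMeasure (expTilt P) := by
  have : Integrable (fun _ => (1 : ℝ)) (expTilt P) := by
    rw [integrable_expTilt_iff]
    simpa [funext weight_zero] using integrable_weight hP 0
  rw [integrable_const_iff] at this
  simpa using this

theorem expTilt_injective : Function.Injective (expTilt (k := k)) := by
  intro P Q h
  have key : ∀ R : Measure (Fin k → ℝ), (expTilt R).withDensity
      (fun u => (ENNReal.ofReal (Real.exp (-∑ i, u i)))⁻¹) = R := fun R =>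
    withDensity_inv_same (by fun_prop) (.of_forall fun u => by simp [Real.exp_pos])
      (.of_forall fun u => by simp)
  rw [← key P, ← key Q, h]

/-- For small |s| every s t_i is at most 1, so the tilt e^{-∑ u_i} absorbs e^{s t·u}. This makes the
tilted measure moment-determinate along each direction. -/
theorem zero_mem_interior_integrableExpSet_expTilt {P : Measure (Fin k → ℝ)} [IsFiniteMeasure P]
    (hP : ∀ᵐ u ∂P, ∀ i, 0 ≤ u i) (t : Fin k → ℝ) :
    0 ∈ interior (integrableExpSet (fun u => t ⬝ᵥ u) (expTilt P)) := by
  have hT : 0 < 1 + ∑ i, |t i| := by positivity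
  rw [mem_interior_iff_mem_nhds]
  refine Filter.mem_of_superset (Metric.ball_mem_nhds 0 (inv_pos.2 hT)) fun s hs => ?_
  rw [mem_ball_zero_iff, Real.norm_eq_abs, ← one_div, lt_div_iff₀ hT] at hs
  have hst : ∀ i, s * t i ≤ 1 := fun i => by
    have h1 : |t i| ≤ ∑ j, |t j| :=
      Finset.single_le_sum (f := fun j => |t j|) (fun j _ => abs_nonneg _) (Finset.mem_univ i)
    have h2 := le_abs_self (s * t i)
    rw [abs_mul] at h2
    nlinarith [abs_nonneg s]
  refine integrable_expTilt_iff.2 (Integrable.of_bound (by fun_prop) 1 ?_)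
  filter_upwards [hP] with u hu
  rw [Real.norm_of_nonneg (by positivity), ← Real.exp_add, Real.exp_le_one_iff, dotProduct,
    Finset.mul_sum, ← Finset.sum_neg_distrib, ← Finset.sum_add_distrib]
  exact Finset.sum_nonpos fun i _ => by nlinarith [hst i, hu i]

theorem integral_dotProduct_pow_expTilt {P : Measure (Fin k → ℝ)} [IsFiniteMeasure P]
    (hP : ∀ᵐ u ∂P, ∀ i, 0 ≤ u i) (t : Fin k → ℝ) (n : ℕ) :
    ∫ u, (t ⬝ᵥ u) ^ n ∂expTilt P =
      ∑ d ∈ ((∑ i, MvPolynomial.C (t i) * MvPolynomial.X i : MvPolynomial (Fin k) ℝ) ^ n).support,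
        ((∑ i, MvPolynomial.C (t i) * MvPolynomial.X i : MvPolynomial (Fin k) ℝ) ^ n).coeff d *
          poissonMoment P d := by
  set p := (∑ i, MvPolynomial.C (t i) * MvPolynomial.X i : MvPolynomial (Fin k) ℝ) ^ n with hp
  have h : ∀ u, Real.exp (-∑ i, u i) * (t ⬝ᵥ u) ^ n =
      ∑ d ∈ p.support, p.coeff d * weight d u := fun u => by
    have : (t ⬝ᵥ u) ^ n = MvPolynomial.eval u p := by simp [hp, dotProduct]
    rw [this, MvPolynomial.eval_eq', Finset.mul_sum]
    exact Finset.sum_congr rfl fun d _ => by rw [weight_eq]; ring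
  rw [integral_expTilt, integral_congr_ae (.of_forall h),
    integral_finsetSum _ fun (d : Fin k →₀ ℕ) _ => (integrable_weight hP d).const_mul _]
  exact Finset.sum_congr rfl fun d _ => integral_const_mul _ _

/-- A finite measure on the nonnegative orthant is determined by its Poisson moments. -/
theorem eq_of_poissonMoment_eq {P Q : Measure (Fin k → ℝ)} [IsFiniteMeasure P] [IsFiniteMeasure Q]
    (hP : ∀ᵐ u ∂P, ∀ i, 0 ≤ u i) (hQ : ∀ᵐ u ∂Q, ∀ i, 0 ≤ u i)
    (h : ∀ y, poissonMoment P y = poissonMoment Q y) : P = Q := by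
  have := isFiniteMeasure_expTilt hP
  have := isFiniteMeasure_expTilt hQ
  refine expTilt_injective (Measure.ext_of_charFunDual (funext fun L => ?_))
  -- Cramér–Wold: it suffices to compare the tilted laws of each linear form t·u, whose moments are
  -- combinations of Poisson moments.
  have hL : (L : (Fin k → ℝ) → ℝ) = fun u => (fun i => L (Pi.single i 1)) ⬝ᵥ u := by
    funext u
    conv_lhs => rw [← Finset.univ_sum_single u, map_sum]
    refine Finset.sum_congr rfl fun i _ => ?_
    rw [← mul_one (u i), ← smul_eq_mul, Pi.single_smul', map_smul]
    simp [mul_comm]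
  rw [charFunDual_eq_charFun_map_one, charFunDual_eq_charFun_map_one, hL,
    map_eq_of_moment_eq (zero_mem_interior_integrableExpSet_expTilt hP _)
      (zero_mem_interior_integrableExpSet_expTilt hQ _) fun n => ?_]
  simp only [integral_dotProduct_pow_expTilt hP, integral_dotProduct_pow_expTilt hQ, h]

/-! ### Poisson moments of gamma laws. -/

theorem measurable_gammaPDF (a r : ℝ) : Measurable (gammaPDF a r) :=
  (measurable_gammaPDFReal a r).ennreal_ofReal

theorem ae_nonneg_gammaMeasure (a r : ℝ) : ∀ᵐ x ∂gammaMeasure a r, 0 ≤ x := by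
  rw [gammaMeasure, ae_withDensity_iff (measurable_gammaPDF a r)]
  refine .of_forall fun x hx => ?_
  by_contra! h
  exact hx (gammaPDF_of_neg h)

theorem integral_pow_mul_exp_neg_gammaMeasure {a r : ℝ} (ha : 0 < a) (hr : 0 < r) (n : ℕ) :
    ∫ x, x ^ n * Real.exp (-x) ∂gammaMeasure a r =
      r ^ a / Real.Gamma a * ((1 / (r + 1)) ^ (a + n) * Real.Gamma (a + n)) := by
  have h1 : ∀ x, (gammaPDF a r x).toReal = gammaPDFReal a r x := fun x =>
    ENNReal.toReal_ofReal (gammaPDFReal_nonneg ha hr x)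
  rw [gammaMeasure, integral_withDensity_eq_integral_toReal_smul
    (measurable_gammaPDF a r) (.of_forall fun x => by simp [gammaPDF])]
  simp only [h1, smul_eq_mul]
  rw [← Real.integral_rpow_mul_exp_neg_mul_Ioi (by positivity) (by positivity),
    ← integral_const_mul, ← integral_Ici_eq_integral_Ioi,
    ← setIntegral_eq_integral_of_forall_compl_eq_zero (s := Set.Ici 0)]
  · rw [integral_Ici_eq_integral_Ioi, integral_Ici_eq_integral_Ioi]
    refine setIntegral_congr_fun measurableSet_Ioi fun x hx => ?_
    have hx : 0 < x := hx
    have e1 : x ^ (a + n - 1) = x ^ (a - 1) * x ^ n := by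
      rw [show a + n - 1 = a - 1 + n by ring, Real.rpow_add hx, Real.rpow_natCast]
    have e2 : Real.exp (-((r + 1) * x)) = Real.exp (-(r * x)) * Real.exp (-x) := by
      rw [← Real.exp_add]; ring_nf
    simp only [gammaPDFReal, if_pos hx.le, e1, e2]
    ring
  · intro x hx
    simp only [Set.mem_Ici] at hx
    simp [gammaPDFReal, hx]

theorem integral_pow_mul_exp_neg_gammaMeasure_pos {a r : ℝ} (ha : 0 < a) (hr : 0 < r) (n : ℕ) :
    0 < ∫ x, x ^ n * Real.exp (-x) ∂gammaMeasure a r := by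
  rw [integral_pow_mul_exp_neg_gammaMeasure ha hr]
  have := Real.Gamma_pos_of_pos ha
  have := Real.Gamma_pos_of_pos (show 0 < a + n by positivity)
  positivity

theorem integral_pow_succ_mul_exp_neg_gammaMeasure {a r : ℝ} (ha : 0 < a) (hr : 0 < r) (n : ℕ) :
    ∫ x, x ^ (n + 1) * Real.exp (-x) ∂gammaMeasure a r =
      (a + n) / (r + 1) * ∫ x, x ^ n * Real.exp (-x) ∂gammaMeasure a r := by
  rw [integral_pow_mul_exp_neg_gammaMeasure ha hr, integral_pow_mul_exp_neg_gammaMeasure ha hr]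
  push_cast
  rw [← add_assoc, Real.Gamma_add_one (by positivity), Real.rpow_add_one (by positivity)]
  ring

/-- The density is positive on (0, l). This will rule out a dark current. -/
theorem nonpos_of_ae_le_gammaMeasure {a r l : ℝ} (ha : 0 < a) (hr : 0 < r)
    (h : ∀ᵐ x ∂gammaMeasure a r, l ≤ x) : l ≤ 0 := by
  by_contra! hl
  rw [gammaMeasure, ae_withDensity_iff (measurable_gammaPDF a r)] at h
  have h0 : volume (Set.Ioo 0 l) = 0 := by
    refine measure_mono_null (fun x hx => ?_) h
    simp only [Set.mem_compl_iff, Set.mem_ofPred_eq, not_forall, not_le]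
    exact ⟨by simpa [gammaPDF] using gammaPDFReal_pos ha hr hx.1, hx.2⟩
  simp [hl.not_ge] at h0

section ProductGamma

variable {a r : Fin k → ℝ}

theorem ae_nonneg_pi_gammaMeasure (ha : ∀ i, 0 < a i) (hr : ∀ i, 0 < r i) :
    ∀ᵐ u ∂Measure.pi (fun i => gammaMeasure (a i) (r i)), ∀ i, 0 ≤ u i := by
  have := fun i => isProbabilityMeasure_gammaMeasure (ha i) (hr i)
  exact ae_all_iff.2 fun i =>
    (measurePreserving_eval (fun i => gammaMeasure (a i) (r i)) i).quasiMeasurePreserving.ae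
      (ae_nonneg_gammaMeasure (a i) (r i))

theorem poissonMoment_pi_gammaMeasure (ha : ∀ i, 0 < a i) (hr : ∀ i, 0 < r i) (y : Fin k → ℕ) :
    poissonMoment (Measure.pi fun i => gammaMeasure (a i) (r i)) y =
      ∏ i, ∫ x, x ^ y i * Real.exp (-x) ∂gammaMeasure (a i) (r i) := by
  have := fun i => isProbabilityMeasure_gammaMeasure (ha i) (hr i)
  exact integral_fintype_prod_eq_prod (fun i x => x ^ y i * Real.exp (-x))

theorem poissonMoment_pi_gammaMeasure_pos (ha : ∀ i, 0 < a i) (hr : ∀ i, 0 < r i)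
    (y : Fin k → ℕ) : 0 < poissonMoment (Measure.pi fun i => gammaMeasure (a i) (r i)) y := by
  rw [poissonMoment_pi_gammaMeasure ha hr]
  exact Finset.prod_pos fun i _ => integral_pow_mul_exp_neg_gammaMeasure_pos (ha i) (hr i) _

theorem poissonMoment_pi_gammaMeasure_add_single (ha : ∀ i, 0 < a i) (hr : ∀ i, 0 < r i)
    (y : Fin k → ℕ) (i : Fin k) :
    poissonMoment (Measure.pi fun i => gammaMeasure (a i) (r i)) (y + Pi.single i 1) =
      (a i + y i) / (r i + 1) *
        poissonMoment (Measure.pi fun i => gammaMeasure (a i) (r i)) y := by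
  rw [poissonMoment_pi_gammaMeasure ha hr, poissonMoment_pi_gammaMeasure ha hr,
    ← Finset.mul_prod_erase _ _ (Finset.mem_univ i), ← Finset.mul_prod_erase _ _ (Finset.mem_univ i),
    ← mul_assoc]
  congr 1
  · simpa using integral_pow_succ_mul_exp_neg_gammaMeasure (ha i) (hr i) (y i)
  · exact Finset.prod_congr rfl fun j hj => by simp [Finset.ne_of_mem_erase hj]

end ProductGamma

/-! ### Affine recursions on ℕ^k. -/

theorem toReal_add_single (y : Fin k → ℕ) (i : Fin k) :
    toReal (y + Pi.single i 1) = toReal y + Pi.single i 1 := by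
  funext j
  rcases eq_or_ne j i with rfl | h <;> simp [toReal, *]

@[simp]
theorem toReal_zero : toReal (0 : Fin k → ℕ) = 0 := by
  funext j; simp [toReal]

/-- Sequences of positive numbers indexed by `ℕ^k` that satisfy an affine recursion with matrix `H`
and offset `c`. -/
structure AffineRecursion (m : (Fin k → ℕ) → ℝ) (H : Matrix (Fin k) (Fin k) ℝ) (c : Fin k → ℝ) :
    Prop where
  pos : ∀ y, 0 < m y
  step : ∀ y i, m (y + Pi.single i 1) = (H *ᵥ toReal y + c) i * m y

namespace AffineRecursion

variable {m m' : (Fin k → ℕ) → ℝ} {H : Matrix (Fin k) (Fin k) ℝ} {c : Fin k → ℝ}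

theorem coeff_pos (h : AffineRecursion m H c) (y : Fin k → ℕ) (i : Fin k) :
    0 < (H *ᵥ toReal y + c) i := by
  have h1 := h.pos (y + Pi.single i 1)
  rw [h.step] at h1
  exact pos_of_mul_pos_left h1 (h.pos y).le

theorem offset_pos (h : AffineRecursion m H c) (i : Fin k) : 0 < c i := by
  simpa using h.coeff_pos 0 i

theorem coeff_add_single (y : Fin k → ℕ) (i j : Fin k) :
    (H *ᵥ toReal (y + Pi.single i 1) + c) j = (H *ᵥ toReal y + c) j + H j i := by
  rw [toReal_add_single, mulVec_add]
  simp only [Pi.add_apply, mulVec_single_one, col_apply]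
  ring

theorem entry_nonneg (h : AffineRecursion m H c) (i j : Fin k) : 0 ≤ H i j := by
  by_contra! hneg
  have hN : ∀ N : ℕ, (H *ᵥ toReal (Pi.single j N) + c) i = N * H i j + c i := by
    intro N
    induction N with
    | zero => simp
    | succ N ih => rw [Pi.single_add, coeff_add_single, ih]; push_cast; ring
  -- A negative entry would make the coefficient negative far out along e_j.
  obtain ⟨N, hN'⟩ := exists_nat_gt (c i / -H i j)
  rw [div_lt_iff₀ (by linarith)] at hN'
  have := h.coeff_pos (Pi.single j N) i
  rw [hN] at this
  linarith

/-- Compute m(y + e_i + e_j) in both orders and cancel the common product of coefficients and m(y).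
-/
theorem coeff_comm (h : AffineRecursion m H c) (y : Fin k → ℕ) (i j : Fin k) :
    (H *ᵥ toReal y + c) i * H j i = (H *ᵥ toReal y + c) j * H i j := by
  have h1 := h.step (y + Pi.single i 1) j
  have h2 := h.step (y + Pi.single j 1) i
  rw [add_right_comm, h2, h.step, h.step, coeff_add_single, coeff_add_single] at h1
  have h3 := (h.pos y).ne'
  apply mul_right_cancel₀ h3
  linarith

theorem offset_comm (h : AffineRecursion m H c) (i j : Fin k) : c i * H j i = c j * H i j := by
  simpa using h.coeff_comm 0 i j

/-- The difference of `coeff_comm` at y = e_l and at y = 0. -/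
theorem entry_comm (h : AffineRecursion m H c) (i j l : Fin k) :
    H i l * H j i = H j l * H i j := by
  have h1 := h.coeff_comm (0 + Pi.single l 1) i j
  rw [coeff_add_single, coeff_add_single] at h1
  have h2 := h.offset_comm i j
  simp only [toReal_zero, mulVec_zero, zero_add] at h1
  linarith

/-- If the rows of the matrix are linearly independent, the matrix is diagonal. -/
theorem isDiag (h : AffineRecursion m H c) (hH : ∀ v, v ᵥ* H = 0 → v = 0) : H.IsDiag := by
  intro i j hij
  by_contra hne
  -- If H_ij ≠ 0, `entry_comm` and `offset_comm` give c_j H_il = c_i H_jl for all l: the two rows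
  -- are proportional.
  have hv : (Pi.single i (c j) - Pi.single j (c i)) ᵥ* H = 0 := by
    funext l
    simp only [sub_vecMul, single_vecMul, Pi.sub_apply, Pi.smul_apply, Pi.zero_apply, row_apply,
      smul_eq_mul, sub_eq_zero]
    have h1 := h.entry_comm i j l
    have h2 := h.offset_comm i j
    apply mul_right_cancel₀ hne
    linear_combination c i * h1 - H i l * h2
  have := congrFun (hH _ hv) i
  simp [hij, (h.offset_pos j).ne'] at this

theorem diag_pos (h : AffineRecursion m H c) (hH : ∀ v, v ᵥ* H = 0 → v = 0) (i : Fin k) :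
    0 < H i i := by
  refine (h.entry_nonneg i i).lt_of_ne' fun h0 => ?_
  have hv : Pi.single i 1 ᵥ* H = 0 := by
    funext l
    rcases eq_or_ne i l with rfl | hl
    · simpa using h0
    · simpa using h.isDiag hH hl
  simpa using congrFun (hH _ hv) i

/-- The recursion determines the sequence up to its value at `0`. -/
theorem eq_mul (h : AffineRecursion m H c) (h' : AffineRecursion m' H c) (y : Fin k → ℕ) :
    m y = m 0 / m' 0 * m' y := by
  induction hs : ∑ i, y i generalizing y with
  | zero =>
    have : y = 0 := funext fun i => by simpa using (Finset.sum_eq_zero_iff.1 hs) i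
    rw [this, div_mul_cancel₀ _ (h'.pos 0).ne']
  | succ s ih =>
    obtain ⟨i, hi⟩ : ∃ i, y i ≠ 0 := by
      by_contra! hy
      simp [hy] at hs
    obtain ⟨z, rfl⟩ : ∃ z : Fin k → ℕ, y = z + Pi.single i 1 := by
      refine ⟨y - Pi.single i 1, funext fun j => ?_⟩
      rcases eq_or_ne j i with rfl | hj
      · simp; omega
      · simp [hj]
    have hz : ∑ j, z j = s := by
      simp only [Pi.add_apply, Finset.sum_add_distrib, Finset.sum_pi_single'] at hs
      simpa using hs
    rw [h.step, h'.step, ih z hz]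
    ring

end AffineRecursion

/-! ### From the recursion to the gamma law. -/

theorem integral_dotProduct_sub_mul_weight {P : Measure (Fin k → ℝ)} [IsFiniteMeasure P]
    (hP : ∀ᵐ u ∂P, ∀ i, 0 ≤ u i) (v : Fin k → ℝ) (a : ℝ) (y : Fin k → ℕ) :
    Integrable (fun u => (v ⬝ᵥ u - a) * weight y u) P ∧
      ∫ u, (v ⬝ᵥ u - a) * weight y u ∂P =
        ∑ i, v i * poissonMoment P (y + Pi.single i 1) - a * poissonMoment P y := by
  have h : (fun u => (v ⬝ᵥ u - a) * weight y u) =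
      fun u => ∑ i, v i * weight (y + Pi.single i 1) u - a * weight y u := by
    funext u
    simp only [weight_add_single, sub_mul, dotProduct, Finset.sum_mul, mul_assoc]
  have hs : Integrable (fun u => ∑ i, v i * weight (y + Pi.single i 1) u) P :=
    integrable_finsetSum _ fun i _ => (integrable_weight hP _).const_mul _
  rw [h]
  refine ⟨hs.sub ((integrable_weight hP y).const_mul a), ?_⟩
  rw [integral_sub hs ((integrable_weight hP y).const_mul a),
    integral_finsetSum _ fun i _ => (integrable_weight hP _).const_mul _]
  simp only [integral_const_mul, poissonMoment]

/-- For a nondegenerate law, an affine recursion of the moments has a nonsingular matrix. -/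
theorem AffineRecursion.eq_zero_of_vecMul_eq_zero {P : Measure (Fin k → ℝ)} [IsFiniteMeasure P]
    (hP : ∀ᵐ u ∂P, ∀ i, 0 ≤ u i) (hnd : Nondegenerate P id)
    {H : Matrix (Fin k) (Fin k) ℝ} {c : Fin k → ℝ}
    (h : AffineRecursion (poissonMoment P) H c) (v : Fin k → ℝ) (hv : v ᵥ* H = 0) : v = 0 := by
  by_contra hne
  set a := v ⬝ᵥ c with ha
  have hint := integral_dotProduct_sub_mul_weight hP v a
  -- With vH = 0 and a = v·c, the recursion makes v·u - a orthogonal to every weight.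
  have hz : ∀ y, ∫ u, (v ⬝ᵥ u - a) * weight y u ∂P = 0 := fun y => by
    rw [(hint y).2]
    simp only [h.step, ← mul_assoc, ← Finset.sum_mul, ← sub_mul]
    change (v ⬝ᵥ (H *ᵥ toReal y + c) - a) * _ = 0
    rw [dotProduct_add, dotProduct_mulVec, hv]
    simp [ha]
  -- The weighted square is itself v·u - a against a combination of weights, so its integral
  -- vanishes and v·u is a.e. constant.
  have hsq : ∀ u, (v ⬝ᵥ u - a) ^ 2 * weight 0 u =
      ∑ i, v i * ((v ⬝ᵥ u - a) * weight (0 + Pi.single i 1) u) -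
        a * ((v ⬝ᵥ u - a) * weight 0 u) := fun u => by
    simp only [weight_add_single]
    have : ∑ i, v i * ((v ⬝ᵥ u - a) * (u i * weight 0 u)) =
        (v ⬝ᵥ u) * ((v ⬝ᵥ u - a) * weight 0 u) := by
      conv_rhs => rw [dotProduct, Finset.sum_mul]
      exact Finset.sum_congr rfl fun i _ => by rw [dotProduct]; ring
    rw [this]
    ring
  have hs : Integrable (fun u =>
      ∑ i, v i * ((v ⬝ᵥ u - a) * weight (0 + Pi.single i 1) u)) P :=
    integrable_finsetSum _ fun i _ => (hint _).1.const_mul _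
  have hsqi : Integrable (fun u => (v ⬝ᵥ u - a) ^ 2 * weight 0 u) P := by
    rw [funext hsq]
    exact hs.sub ((hint 0).1.const_mul a)
  have hsq0 : ∫ u, (v ⬝ᵥ u - a) ^ 2 * weight 0 u ∂P = 0 := by
    rw [funext hsq, integral_sub hs ((hint 0).1.const_mul a),
      integral_finsetSum _ fun i _ => (hint _).1.const_mul _]
    simp only [integral_const_mul, hz]
    simp
  rw [integral_eq_zero_iff_of_nonneg
    (fun u => mul_nonneg (sq_nonneg _) (by rw [weight_zero]; positivity)) hsqi] at hsq0
  refine hnd v hne ⟨a, ?_⟩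
  filter_upwards [hsq0] with u hu
  simpa [weight_zero, sub_eq_zero] using hu

/-- Pointwise, ∑ u_i^n/n! ≤ e^{u_i} ≤ e^{∑ u_j}. -/
theorem sum_poissonMoment_single_div_factorial_le {P : Measure (Fin k → ℝ)}
    [IsProbabilityMeasure P] (hP : ∀ᵐ u ∂P, ∀ i, 0 ≤ u i) (i : Fin k) (N : ℕ) :
    ∑ n ∈ Finset.range N, poissonMoment P (Pi.single i n) / n.factorial ≤ 1 := by
  have hi : ∀ n : ℕ, Integrable (fun u => weight (Pi.single i n) u / n.factorial) P := fun n =>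
    (integrable_weight hP _).div_const _
  have : ∑ n ∈ Finset.range N, poissonMoment P (Pi.single i n) / n.factorial =
      ∫ u, ∑ n ∈ Finset.range N, weight (Pi.single i n) u / n.factorial ∂P := by
    rw [integral_finsetSum _ fun n _ => hi n]
    simp only [integral_div, poissonMoment]
  rw [this]
  calc _ ≤ ∫ _, (1 : ℝ) ∂P := by
        refine integral_mono_ae (integrable_finsetSum _ fun n _ => hi n) (integrable_const _) ?_
        filter_upwards [hP] with u hu
        have hw : ∀ n : ℕ, weight (Pi.single i n) u = Real.exp (-∑ j, u j) * u i ^ n := fun n => by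
          rw [weight_eq, Finset.prod_eq_single i (fun j _ hj => by simp [hj]) (by simp)]
          simp
        simp only [hw, mul_div_assoc, ← Finset.mul_sum]
        rw [Real.exp_neg, inv_mul_le_iff₀ (Real.exp_pos _), mul_one]
        exact (Real.sum_le_exp_of_nonneg (hu i) N).trans
          (Real.exp_le_exp.2 (Finset.single_le_sum (fun j _ => hu j) (Finset.mem_univ i)))
    _ = 1 := by simp

theorem AffineRecursion.diag_lt_one {P : Measure (Fin k → ℝ)} [IsProbabilityMeasure P]
    (hP : ∀ᵐ u ∂P, ∀ i, 0 ≤ u i) {H : Matrix (Fin k) (Fin k) ℝ} {c : Fin k → ℝ}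
    (h : AffineRecursion (poissonMoment P) H c) (i : Fin k) : H i i < 1 := by
  by_contra! hge
  set p : ℕ → ℝ := fun n => poissonMoment P (Pi.single i n) / n.factorial with hp
  have hppos : ∀ n, 0 < p n := fun n => div_pos (h.pos _) (by positivity)
  have hstep : ∀ n : ℕ, (n + 1) * p (n + 1) = (H i i * n + c i) * p n := fun n => by
    have : (H *ᵥ toReal (Pi.single i n) + c) i = H i i * n + c i := by
      have : toReal (Pi.single i n) = Pi.single i (n : ℝ) := by
        funext j
        rcases eq_or_ne j i with rfl | hj <;> simp [toReal, *]
      simp [this]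
    simp only [hp, Pi.single_add, h.step, this, Nat.factorial_succ]
    push_cast
    field_simp
  -- If H_ii ≥ 1, then n p(n) is nondecreasing, so p(n) ≥ p(1)/n for n ≥ 1, and the harmonic series
  -- contradicts summability of p.
  have hmono : ∀ n : ℕ, p 1 ≤ (n + 1) * p (n + 1) := by
    intro n
    induction n with
    | zero => simp
    | succ n ih =>
      refine ih.trans ?_
      rw [hstep (n + 1)]
      have := h.offset_pos i
      refine mul_le_mul_of_nonneg_right ?_ (hppos (n + 1)).le
      push_cast
      nlinarith [(n.cast_nonneg : (0 : ℝ) ≤ n)]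
  have hsum : Summable p := summable_of_sum_range_le (fun n => (hppos n).le)
    (sum_poissonMoment_single_div_factorial_le hP i)
  have hsum' : Summable fun n : ℕ => p 1 * (1 / ((n : ℝ) + 1)) := by
    refine Summable.of_nonneg_of_le (fun n => by have := hppos 1; positivity) (fun n => ?_)
      ((summable_nat_add_iff 1).2 hsum)
    rw [mul_one_div, div_le_iff₀ (by positivity), mul_comm]
    exact hmono n
  rw [summable_mul_left_iff (hppos 1).ne'] at hsum'
  refine Real.not_summable_one_div_natCast ((summable_nat_add_iff 1).1 ?_)
  simpa using hsum'

/-- Shape a = c_i/H_ii and rate r = (1 - H_ii)/H_ii are chosen so that r + 1 = 1/H_ii, hence (a +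
y_i)/(r + 1) = H_ii y_i + c_i. -/
theorem affineRecursion_pi_gammaMeasure {H : Matrix (Fin k) (Fin k) ℝ} {c : Fin k → ℝ}
    (hH : H.IsDiag) (hH' : ∀ i, 0 < H i i ∧ H i i < 1) (hc : ∀ i, 0 < c i) :
    AffineRecursion (poissonMoment
      (Measure.pi fun i => gammaMeasure (c i / H i i) ((1 - H i i) / H i i))) H c := by
  have ha : ∀ i, 0 < c i / H i i := fun i => div_pos (hc i) (hH' i).1
  have hr : ∀ i, 0 < (1 - H i i) / H i i := fun i => div_pos (by linarith [(hH' i).2]) (hH' i).1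
  refine ⟨poissonMoment_pi_gammaMeasure_pos ha hr, fun y i => ?_⟩
  rw [poissonMoment_pi_gammaMeasure_add_single ha hr]
  congr 1
  have : (H *ᵥ toReal y) i = H i i * y i := by
    rw [mulVec, dotProduct, Finset.sum_eq_single i (fun j _ hj => by rw [hH hj.symm, zero_mul])
      (by simp)]
    rfl
  have h0 := (hH' i).1.ne'
  rw [Pi.add_apply, this]
  field_simp
  ring

/-- A law on the nonnegative orthant whose Poisson moments satisfy an affine recursion with a
diagonal matrix is a product of gamma laws. -/
theorem AffineRecursion.eq_pi_gammaMeasure {P : Measure (Fin k → ℝ)} [IsProbabilityMeasure P]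
    (hP : ∀ᵐ u ∂P, ∀ i, 0 ≤ u i) {H : Matrix (Fin k) (Fin k) ℝ} {c : Fin k → ℝ}
    (h : AffineRecursion (poissonMoment P) H c)
    (hH : H.IsDiag) (hH' : ∀ i, 0 < H i i ∧ H i i < 1) :
    P = Measure.pi fun i => gammaMeasure (c i / H i i) ((1 - H i i) / H i i) := by
  have hc := h.offset_pos
  have ha : ∀ i, 0 < c i / H i i := fun i => div_pos (hc i) (hH' i).1
  have hr : ∀ i, 0 < (1 - H i i) / H i i := fun i => div_pos (by linarith [(hH' i).2]) (hH' i).1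
  have := fun i => isProbabilityMeasure_gammaMeasure (ha i) (hr i)
  have hQ := affineRecursion_pi_gammaMeasure hH hH' hc
  have hQ0 := ae_nonneg_pi_gammaMeasure ha hr
  set Q := Measure.pi fun i => gammaMeasure (c i / H i i) ((1 - H i i) / H i i)
  -- The recursion fixes the moments only up to a factor; comparing total masses later gives κ = 1.
  set κ : NNReal := (poissonMoment P 0 / poissonMoment Q 0).toNNReal
  have hκ' : (κ : ℝ) = poissonMoment P 0 / poissonMoment Q 0 :=
    Real.coe_toNNReal _ (div_pos (h.pos 0) (hQ.pos 0)).le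
  have hPQ : P = κ • Q := by
    refine eq_of_poissonMoment_eq hP (Measure.ae_smul_measure hQ0 κ) fun y => ?_
    rw [h.eq_mul hQ, ← hκ', poissonMoment, poissonMoment, integral_smul_nnreal_measure]
    rfl
  have h1 : κ = 1 := by
    have := congrArg (fun R => R Set.univ) hPQ
    simp only [measure_univ, Measure.smul_apply, ENNReal.smul_def, smul_eq_mul, mul_one] at this
    exact_mod_cast this.symm
  rw [hPQ, h1, one_smul]

/-! ### Conditional means of the channel as moment ratios. -/

variable {Ω : Type*} [MeasurableSpace Ω] {μ : Measure Ω} {n : ℕ}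

theorem channelPMF_eq (A : Matrix (Fin k) (Fin n) ℝ) (lam : Fin k → ℝ) (x : Fin n → ℝ)
    (y : Fin k → ℕ) :
    channelPMF A lam x y = weight y (A *ᵥ x + lam) / ∏ i, ((y i).factorial : ℝ) := by
  simp [channelPMF, weight, Finset.prod_div_distrib]

section Output

variable {A : Matrix (Fin k) (Fin n) ℝ} {lam : Fin k → ℝ} {X : Ω → Fin n → ℝ} {Y : Ω → Fin k → ℕ}

theorem measurable_mulVec_add (A : Matrix (Fin k) (Fin n) ℝ) (lam : Fin k → ℝ) :
    Measurable fun x : Fin n → ℝ => A *ᵥ x + lam := by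
  have : Continuous fun x : Fin n → ℝ => A *ᵥ x + lam := by fun_prop
  exact this.measurable

/-- The law of `A X + λ` on the event `Y = y`. -/
theorem IsPoissonOutput.map_restrict (hX : Measurable X) (h : IsPoissonOutput μ A lam X Y)
    (y : Fin k → ℕ) :
    (μ.restrict (Y ⁻¹' {y})).map (fun ω => A *ᵥ X ω + lam) =
      (μ.map fun ω => A *ᵥ X ω + lam).withDensity
        fun u => ENNReal.ofReal (weight y u / ∏ i, ((y i).factorial : ℝ)) := by
  have hf := measurable_mulVec_add A lam
  have hU : Measurable fun ω => A *ᵥ X ω + lam := hf.comp hX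
  ext B hB
  rw [Measure.map_apply hU hB, Measure.restrict_apply (hU hB), withDensity_apply _ hB]
  have hm : (μ.map fun ω => A *ᵥ X ω + lam) = (μ.map X).map fun x => A *ᵥ x + lam :=
    (Measure.map_map hf hX).symm
  rw [hm, setLIntegral_map hB (by fun_prop) hf]
  simp only [← channelPMF_eq]
  exact h _ (hf hB) y

theorem ae_map_nonneg {U : Ω → Fin k → ℝ} (hU : Measurable U) (h : ∀ᵐ ω ∂μ, ∀ i, 0 ≤ U ω i) :
    ∀ᵐ u ∂(μ.map U), ∀ i, 0 ≤ u i := by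
  rw [ae_all_iff] at h ⊢
  exact fun i => (ae_map_iff hU.aemeasurable
    (measurableSet_le measurable_const (measurable_pi_apply i))).2 (h i)

theorem IsPoissonOutput.integral_restrict (hX : Measurable X) (h : IsPoissonOutput μ A lam X Y)
    (hU0 : ∀ᵐ ω ∂μ, ∀ i, 0 ≤ (A *ᵥ X ω + lam) i) (y : Fin k → ℕ) {g : (Fin k → ℝ) → ℝ}
    (hg : Measurable g) :
    (IntegrableOn (fun ω => g (A *ᵥ X ω + lam)) (Y ⁻¹' {y}) μ ↔
      Integrable (fun u => g u * weight y u) (μ.map fun ω => A *ᵥ X ω + lam)) ∧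
    ∫ ω in Y ⁻¹' {y}, g (A *ᵥ X ω + lam) ∂μ =
      (∫ u, g u * weight y u ∂(μ.map fun ω => A *ᵥ X ω + lam)) /
        ∏ i, ((y i).factorial : ℝ) := by
  have hU : Measurable fun ω => A *ᵥ X ω + lam := (measurable_mulVec_add A lam).comp hX
  have hfac : (∏ i, ((y i).factorial : ℝ)) ≠ 0 := Finset.prod_ne_zero_iff.2 fun i _ => by positivity
  have hfac0 : 0 ≤ ∏ i, ((y i).factorial : ℝ) := by positivity
  have hae : ∀ᵐ u ∂(μ.map fun ω => A *ᵥ X ω + lam),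
      (ENNReal.ofReal (weight y u / ∏ i, ((y i).factorial : ℝ))).toReal • g u =
        (∏ i, ((y i).factorial : ℝ))⁻¹ * (g u * weight y u) := by
    filter_upwards [ae_map_nonneg hU hU0] with u hu
    rw [ENNReal.toReal_ofReal (div_nonneg (weight_nonneg y hu) hfac0), smul_eq_mul]
    ring
  have hden : Measurable fun u : Fin k → ℝ =>
      ENNReal.ofReal (weight y u / ∏ i, ((y i).factorial : ℝ)) := by fun_prop
  constructor
  · rw [IntegrableOn, ← Function.comp_def g, ← integrable_map_measure hg.aestronglyMeasurable
      hU.aemeasurable, h.map_restrict hX, integrable_withDensity_iff_integrable_smul' hden (by simp),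
      integrable_congr hae, integrable_const_mul_iff (IsUnit.mk0 _ (inv_ne_zero hfac))]
  · rw [← integral_map hU.aemeasurable hg.aestronglyMeasurable, h.map_restrict hX,
      integral_withDensity_eq_integral_toReal_smul hden (by simp), integral_congr_ae hae,
      integral_const_mul, div_eq_inv_mul]

/-- The conditional means of `A X + λ` in terms of the Poisson moments of its law. -/
theorem IsPoissonOutput.hasCondMean_iff [IsFiniteMeasure μ] (hX : Measurable X)
    (h : IsPoissonOutput μ A lam X Y) (hU0 : ∀ᵐ ω ∂μ, ∀ i, 0 ≤ (A *ᵥ X ω + lam) i)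
    (y : Fin k → ℕ) (z : Fin k → ℝ) :
    HasCondMean μ (fun ω => A *ᵥ X ω + lam) Y y z ↔
      0 < poissonMoment (μ.map fun ω => A *ᵥ X ω + lam) y ∧
        ∀ i, poissonMoment (μ.map fun ω => A *ᵥ X ω + lam) (y + Pi.single i 1) =
          z i * poissonMoment (μ.map fun ω => A *ᵥ X ω + lam) y := by
  have hU : Measurable fun ω => A *ᵥ X ω + lam := (measurable_mulVec_add A lam).comp hX
  have hfac : 0 < ∏ i, ((y i).factorial : ℝ) := Finset.prod_pos fun i _ => by positivity
  have hP0 := ae_map_nonneg hU hU0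
  set P := μ.map fun ω => A *ᵥ X ω + lam with hP
  have : IsFiniteMeasure P := Measure.isFiniteMeasure_map _ _
  have hmass : μ.real (Y ⁻¹' {y}) = poissonMoment P y / ∏ i, ((y i).factorial : ℝ) := by
    have := (h.integral_restrict hX hU0 y (g := fun _ => 1) measurable_const).2
    simpa [poissonMoment] using this
  have hmean : ∀ i, ∫ ω in Y ⁻¹' {y}, (A *ᵥ X ω + lam) i ∂μ =
      poissonMoment P (y + Pi.single i 1) / ∏ i, ((y i).factorial : ℝ) := fun i => by
    rw [(h.integral_restrict hX hU0 y (g := fun u => u i) (measurable_pi_apply i)).2]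
    simp only [poissonMoment, weight_add_single, ← hP]
  -- Integrability is automatic: u_i times the weight at y is the bounded weight at y + e_i.
  have hint : ∀ i, IntegrableOn (fun ω => (A *ᵥ X ω + lam) i) (Y ⁻¹' {y}) μ := fun i => by
    rw [(h.integral_restrict hX hU0 y (g := fun u => u i) (measurable_pi_apply i)).1]
    exact (integrable_weight hP0 (y + Pi.single i 1)).congr
      (.of_forall fun u => weight_add_single y i u)
  have hpos : 0 < μ (Y ⁻¹' {y}) ↔ 0 < poissonMoment P y := by
    rw [← div_pos_iff_of_pos_right hfac, ← hmass, measureReal_def, ENNReal.toReal_pos_iff]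
    simp
  rw [HasCondMean, hpos]
  refine and_congr_right fun hm => ?_
  have hI : IntegrableOn (fun ω => A *ᵥ X ω + lam) (Y ⁻¹' {y}) μ := Integrable.of_eval hint
  rw [and_iff_right hI, ProbabilityTheory.cond, integral_smul_measure, funext_iff]
  refine forall_congr' fun i => ?_
  rw [Pi.smul_apply, eval_integral hint, hmean, ENNReal.toReal_inv, ← measureReal_def, hmass,
    smul_eq_mul, inv_div, mul_comm, div_mul_div_cancel₀ hfac.ne', div_eq_iff hm.ne']

end Output

theorem HasCondMean.mulVec {m l : ℕ} {Z : Ω → Fin m → ℝ} {Y : Ω → Fin k → ℕ} {y : Fin k → ℕ}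
    {z : Fin m → ℝ} (h : HasCondMean μ Z Y y z) (M : Matrix (Fin l) (Fin m) ℝ) :
    HasCondMean μ (fun ω => M *ᵥ Z ω) Y y (M *ᵥ z) := by
  obtain ⟨h0, hi, he⟩ := h
  let L : (Fin m → ℝ) →L[ℝ] (Fin l → ℝ) := LinearMap.toContinuousLinearMap M.mulVecLin
  refine ⟨h0, L.integrable_comp hi, ?_⟩
  rw [← he]
  exact L.integral_comp_comm (hi.smul_measure (ENNReal.inv_ne_top.2 h0.ne'))

theorem HasCondMean.add_const [IsFiniteMeasure μ] {m : ℕ} {Z : Ω → Fin m → ℝ}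
    {Y : Ω → Fin k → ℕ} {y : Fin k → ℕ} {z : Fin m → ℝ} (h : HasCondMean μ Z Y y z)
    (w : Fin m → ℝ) : HasCondMean μ (fun ω => Z ω + w) Y y (z + w) := by
  obtain ⟨h0, hi, he⟩ := h
  have := cond_isProbabilityMeasure (μ := μ) h0.ne'
  refine ⟨h0, hi.add (integrable_const w), ?_⟩
  have hi' : Integrable Z μ[|Y ⁻¹' {y}] := hi.smul_measure (ENNReal.inv_ne_top.2 h0.ne')
  rw [integral_add hi' (integrable_const w), he]
  simp

theorem ProductGammaConditions.isUnit_det {lam : Fin k → ℝ}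
    {A C : Matrix (Fin k) (Fin k) ℝ} {X : Ω → Fin k → ℝ}
    {b : Fin k → ℝ} (h : ProductGammaConditions μ A lam X C b) : IsUnit A.det := by
  have h1 : (A * C).det ≠ 0 := by
    rw [← h.isDiag.diagonal_diag, det_diagonal]
    exact Finset.prod_ne_zero_iff.2 fun i _ => (h.diag_mem i).1.ne'
  rw [det_mul] at h1
  exact isUnit_iff_ne_zero.2 (left_ne_zero_of_mul h1)

/-! ### The two implications. -/

section Characterization

variable [IsProbabilityMeasure μ] {A : Matrix (Fin k) (Fin n) ℝ} {lam : Fin k → ℝ}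
  {X : Ω → Fin n → ℝ} {Y : Ω → Fin k → ℕ} {C : Matrix (Fin n) (Fin k) ℝ} {b : Fin n → ℝ}

theorem productGammaConditions_of_hasCondMean (hlam : ∀ i, 0 ≤ lam i) (hX : Measurable X)
    (hAX : ∀ᵐ ω ∂μ, ∀ i, 0 ≤ (A *ᵥ X ω) i) (hXY : IsPoissonOutput μ A lam X Y)
    (hU : Nondegenerate μ (fun ω => A *ᵥ X ω + lam))
    (h : ∀ y, HasCondMean μ X Y y (C *ᵥ toReal y + b)) :
    ProductGammaConditions μ A lam X C b := by
  have hUm : Measurable fun ω => A *ᵥ X ω + lam := (measurable_mulVec_add A lam).comp hX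
  have hU0 : ∀ᵐ ω ∂μ, ∀ i, 0 ≤ (A *ᵥ X ω + lam) i := by
    filter_upwards [hAX] with ω hω i using add_nonneg (hω i) (hlam i)
  have hlamU : ∀ i, ∀ᵐ u ∂(μ.map fun ω => A *ᵥ X ω + lam), lam i ≤ u i := fun i => by
    rw [ae_map_iff hUm.aemeasurable (measurableSet_le measurable_const (measurable_pi_apply i))]
    filter_upwards [hAX] with ω hω
    simpa using hω i
  have hP0 : ∀ᵐ u ∂(μ.map fun ω => A *ᵥ X ω + lam), ∀ i, 0 ≤ u i :=
    ae_all_iff.2 fun i => (hlamU i).mono fun u hu => (hlam i).trans hu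
  have hrec : AffineRecursion (poissonMoment (μ.map fun ω => A *ᵥ X ω + lam)) (A * C)
      (A *ᵥ b + lam) := by
    have key := fun y => (hXY.hasCondMean_iff hX hU0 y _).1 (((h y).mulVec A).add_const lam)
    refine ⟨fun y => (key y).1, fun y i => ?_⟩
    rw [(key y).2 i, mulVec_add, mulVec_mulVec, add_assoc]
  have hnd : Nondegenerate (μ.map fun ω => A *ᵥ X ω + lam) id := by
    rintro v hv ⟨a, ha⟩
    exact hU v hv ⟨a, ae_of_ae_map hUm.aemeasurable ha⟩
  have : IsProbabilityMeasure (μ.map fun ω => A *ᵥ X ω + lam) :=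
    Measure.isProbabilityMeasure_map hUm.aemeasurable
  have hker := hrec.eq_zero_of_vecMul_eq_zero hP0 hnd
  have hdiag := hrec.isDiag hker
  have hmem : ∀ i, 0 < (A * C) i i ∧ (A * C) i i < 1 := fun i =>
    ⟨hrec.diag_pos hker i, hrec.diag_lt_one hP0 i⟩
  have hlaw := hrec.eq_pi_gammaMeasure hP0 hdiag hmem
  have ha : ∀ i, 0 < (A *ᵥ b + lam) i / (A * C) i i := fun i =>
    div_pos (hrec.offset_pos i) (hmem i).1
  have hr : ∀ i, 0 < (1 - (A * C) i i) / (A * C) i i := fun i =>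
    div_pos (by linarith [(hmem i).2]) (hmem i).1
  have hprob := fun i => isProbabilityMeasure_gammaMeasure (ha i) (hr i)
  -- The i-th marginal is a gamma law supported above λ_i.
  have hlam0 : lam = 0 := by
    funext i
    refine le_antisymm (nonpos_of_ae_le_gammaMeasure (ha i) (hr i) ?_) (hlam i)
    have h1 := hlamU i
    rw [hlaw] at h1
    rw [← (measurePreserving_eval (fun i => gammaMeasure ((A *ᵥ b + lam) i / (A * C) i i)
      ((1 - (A * C) i i) / (A * C) i i)) i).map_eq]
    exact (ae_map_iff (measurable_pi_apply i).aemeasurable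
      (measurableSet_le measurable_const measurable_id)).2 h1
  subst hlam0
  exact ⟨rfl, hdiag, hmem, by simpa using hrec.offset_pos, by simpa using hlaw⟩

theorem ProductGammaConditions.hasCondMean (hX : Measurable X)
    (hAX : ∀ᵐ ω ∂μ, ∀ i, 0 ≤ (A *ᵥ X ω) i) (hXY : IsPoissonOutput μ A lam X Y)
    (h : ProductGammaConditions μ A lam X C b) (y : Fin k → ℕ) :
    HasCondMean μ (fun ω => A *ᵥ X ω) Y y (A *ᵥ (C *ᵥ toReal y + b)) := by
  obtain ⟨rfl, hdiag, hmem, hpos, hlaw⟩ := h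
  have hrec := affineRecursion_pi_gammaMeasure hdiag hmem hpos
  rw [← hlaw] at hrec
  have key := (hXY.hasCondMean_iff hX (by simpa using hAX) y (A *ᵥ (C *ᵥ toReal y + b))).2
  simp only [add_zero] at key
  refine key ⟨hrec.pos y, fun i => ?_⟩
  rw [hrec.step, mulVec_add, mulVec_mulVec]

end Characterization

end PoissonChannel

theorem corollary1 {Ω : Type*} [MeasurableSpace Ω] (μ : Measure Ω) [IsProbabilityMeasure μ]
    {k n : ℕ} (A : Matrix (Fin k) (Fin n) ℝ) (lam : Fin k → ℝ) (hlam : ∀ i, 0 ≤ lam i)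
    (X : Ω → Fin n → ℝ) (hX : Measurable X) (Y : Ω → Fin k → ℕ) (hY : Measurable Y)
    (hAX : ∀ᵐ ω ∂μ, ∀ i, 0 ≤ (A *ᵥ X ω) i)
    (hXY : PoissonChannel.IsPoissonOutput μ A lam X Y)
    (hU : PoissonChannel.Nondegenerate μ (fun ω => A *ᵥ X ω + lam))
    (C : Matrix (Fin n) (Fin k) ℝ) (b : Fin n → ℝ) :
    (k = n →
      ((∀ y, PoissonChannel.HasCondMean μ X Y y (C *ᵥ PoissonChannel.toReal y + b)) ↔
        PoissonChannel.ProductGammaConditions μ A lam X C b)) ∧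
    ((∀ y, PoissonChannel.HasCondMean μ X Y y (C *ᵥ PoissonChannel.toReal y + b)) →
      PoissonChannel.ProductGammaConditions μ A lam X C b) ∧
    (PoissonChannel.ProductGammaConditions μ A lam X C b →
      ∀ y, PoissonChannel.HasCondMean μ (fun ω => A *ᵥ X ω) Y y
        (A *ᵥ (C *ᵥ PoissonChannel.toReal y + b))) := by
  have hfwd := PoissonChannel.productGammaConditions_of_hasCondMean (C := C) (b := b)
    hlam hX hAX hXY hU
  refine ⟨?_, hfwd, fun h => h.hasCondMean hX hAX hXY⟩
  rintro rfl
  refine ⟨hfwd, fun h y => ?_⟩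
  -- For k = n the conditional mean of X is recovered from that of AX by A⁻¹.
  simpa [mulVec_mulVec, nonsing_inv_mul _ h.isUnit_det] using (h.hasCondMean hX hAX hXY y).mulVec A⁻¹
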